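/- For $\pi\in S_n$ let $c_{1324}(\pi)$ be the number of occurrences of $1324$ in $\pi$ as a consecutive pattern, that is, the number of indices $i$ with $1\le i\le n-3$ such that $\pi_i<\pi_{i+2}<\pi_{i+1}<\pi_{i+3}$. Let $$P_{1324}(u,z)=\sum_{n\ge0}\sum_{\pi\in S_n}u^{c_{1324}(\pi)}\frac{z^n}{n!},\qquad \omega_{1324}(u,z)=\frac{1}{P_{1324}(u,z)},$$ regarded as formal power series in $z$, where $u$ is an indeterminate (or, more generally, any element of a commutative $\mathbb{Q}$-algebra $R$). **Theorem.** Let $\omega(z)=\omega_{1324}(u,z)$, and let primes and superscripts denote derivatives with respect to $z$. Then $\omega$ is the unique formal power series solution in $z$ of $$z\omega^{(5)}-((u-1)z-3)\omega^{(4)}-3(u-1)(2z+1)\omega^{(3)}+(u-1)((4u-5)z-6)\omega''+(u-1)(8(u-1)z-3)\omega'+4(u-1)^2z\,\omega=0$$ with $\omega(0)=1$, $\omega'(0)=-1$, $\omega''(0)=\omega^{(3)}(0)=0$. -/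

import Mathlib

open scoped Nat PowerSeries

namespace ConsecutivePattern

/-- `OccursAt σ π i`: the pattern `σ ∈ S_m` occurs consecutively in `π ∈ S_n` at the (zero-based)
position `i`, that is, the window `π_i π_{i+1} ⋯ π_{i+m-1}` lies inside `π` and its entries are in
the same relative order as `σ`, so that its reduction is `σ`. -/
def OccursAt {m n : ℕ} (σ : Equiv.Perm (Fin m)) (π : Equiv.Perm (Fin n)) (i : ℕ) : Prop :=
  ∃ h : i + m ≤ n, ∀ a b : Fin m,
    π ⟨i + a, by omega⟩ < π ⟨i + b, by omega⟩ ↔ σ a < σ b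

instance {m n : ℕ} (σ : Equiv.Perm (Fin m)) (π : Equiv.Perm (Fin n)) :
    DecidablePred (OccursAt σ π) := fun i => by
  unfold OccursAt
  infer_instance

/-- `c_σ(π)`: the number of occurrences of `σ` in `π` as a consecutive pattern. (An occurrence
starts at a position `i ≤ n`, since `i + m ≤ n`.) -/
def occurrences {m n : ℕ} (σ : Equiv.Perm (Fin m)) (π : Equiv.Perm (Fin n)) : ℕ :=
  ((Finset.range (n + 1)).filter (OccursAt σ π)).card

/-- `P_σ(u, z) = ∑_{n ≥ 0} ∑_{π ∈ S_n} u ^ {c_σ(π)} z ^ n / n!` as a formal power series in `z`,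
where `u` is an element of a commutative `ℚ`-algebra `R`. The bivariate generating function is the
case `R = ℚ[u]` with `u` the indeterminate. -/
noncomputable def genFun {R : Type*} [CommRing R] [Algebra ℚ R] {m : ℕ}
    (σ : Equiv.Perm (Fin m)) (u : R) : R⟦X⟧ :=
  PowerSeries.mk fun n =>
    algebraMap ℚ R (1 / (n ! : ℚ)) * ∑ π : Equiv.Perm (Fin n), u ^ occurrences σ π

/-- `ω_σ(u, z) = 1 / P_σ(u, z)`, the multiplicative inverse in the ring of formal power series
in `z`; see `genFun_mul_omega`. -/
noncomputable def omega {R : Type*} [CommRing R] [Algebra ℚ R] {m : ℕ}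
    (σ : Equiv.Perm (Fin m)) (u : R) : R⟦X⟧ :=
  Ring.inverse (genFun σ u)

/-- For a nonempty pattern, `ω_σ` is a genuine inverse of `P_σ`. -/
theorem genFun_mul_omega {R : Type*} [CommRing R] [Algebra ℚ R] {m : ℕ} (hm : 0 < m)
    (σ : Equiv.Perm (Fin m)) (u : R) : genFun σ u * omega σ u = 1 := by
  apply Ring.mul_inverse_cancel
  rw [PowerSeries.isUnit_iff_constantCoeff]
  have h0 : ∀ π : Equiv.Perm (Fin 0), occurrences σ π = 0 := by
    intro π
    unfold occurrences
    rw [Finset.card_eq_zero, Finset.filter_eq_empty_iff]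
    rintro i - ⟨h, -⟩
    omega
  have h1 : PowerSeries.constantCoeff (genFun σ u) = 1 := by
    rw [← PowerSeries.coeff_zero_eq_constantCoeff_apply, genFun, PowerSeries.coeff_mk]
    simp [h0]
  rw [h1]
  exact isUnit_one

/-- The pattern `1324` (written with the values `0, 1, 2, 3`). -/
def pattern1324 : Equiv.Perm (Fin 4) where
  toFun := ![0, 2, 1, 3]
  invFun := ![0, 2, 1, 3]
  left_inv := by decide
  right_inv := by decide

end ConsecutivePattern

/-! The proof is the cluster method. Put `t = u - 1` and expand `(t + 1) ^ c(π)` over sets `S` of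
marked occurrences. For fixed `S`, the permutations having occurrences at all of `S` are the linear
extensions of a relation on positions (`sum_pow_occurrences`).

Two marks at adjacent positions force a cycle, so overlapping marks are 2 or 3 apart. A maximal
block of `k` marks spaced by 2 forms a chain, then a `2 × k` Young tableau shape, then a maximum. It
has `catalan k` linear extensions and may be traded for a chain of the same size (`linExt_block`,
`linExt_of_block`). Hence the first cluster of a marked permutation is a sequence of blocks of
length `2k + 1` and weight `catalan k * t ^ k`, closed by one last element, with ordinary generating
function `K = x / (1 - x (c(t x²) - 1))` (`markedSum_eq_pairing`). Splitting off this first cluster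
shows that `n! [zⁿ] ω = [xⁿ] (1 - K)` (`omega_pattern1324_eq`).

Since `c` is quadratic, `K` is algebraic of degree at most 2, hence `1 - K` satisfies a first-order
linear differential equation (`differential_eq_clusterSeries`). On coefficients this is a
recurrence, and the same recurrence for `n! [zⁿ] f` is the fifth-order equation for `f`
(`differential_eq_iff_omegaRecurrence`). Its leading coefficient `n + 3` is invertible, so four
initial values determine the solution. -/

namespace ConsecutivePattern

/-! ### Linear extensions of a relation on a finite set -/

open Classical in
/-- The number of ways of removing `k` elements from `P`, one at a time, each of them minimal for
`r` among those left. -/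
noncomputable def linExtAux (r : ℕ → ℕ → Prop) : ℕ → Finset ℕ → ℕ
  | 0, _ => 1
  | k + 1, P => ∑ x ∈ P.filter (fun x => ∀ y ∈ P, ¬ r y x), linExtAux r k (P.erase x)

/-- The number of linear extensions of the relation `r` restricted to `P`. -/
noncomputable def linExt (r : ℕ → ℕ → Prop) (P : Finset ℕ) : ℕ := linExtAux r P.card P

open Classical in
/-- The elements of `P` that are minimal for `r`. -/
noncomputable def minimals (r : ℕ → ℕ → Prop) (P : Finset ℕ) : Finset ℕ :=
  P.filter (fun x => ∀ y ∈ P, ¬ r y x)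

theorem mem_minimals {r : ℕ → ℕ → Prop} {P : Finset ℕ} {x : ℕ} :
    x ∈ minimals r P ↔ x ∈ P ∧ ∀ y ∈ P, ¬ r y x := by
  simp [minimals]

@[simp] theorem linExt_empty (r : ℕ → ℕ → Prop) : linExt r ∅ = 1 := rfl

theorem linExt_eq_sum {r : ℕ → ℕ → Prop} {P : Finset ℕ} (hP : P.Nonempty) :
    linExt r P = ∑ x ∈ minimals r P, linExt r (P.erase x) := by
  obtain ⟨k, hk⟩ : ∃ k, P.card = k + 1 := ⟨P.card - 1, by have := hP.card_pos; omega⟩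
  rw [linExt, hk, linExtAux]
  refine Finset.sum_congr rfl fun x hx => ?_
  rw [linExt, Finset.card_erase_of_mem (mem_minimals.1 hx).1, hk, Nat.add_sub_cancel]

theorem linExt_congr {r r' : ℕ → ℕ → Prop} {P : Finset ℕ}
    (h : ∀ x ∈ P, ∀ y ∈ P, r x y ↔ r' x y) : linExt r P = linExt r' P := by
  induction P using Finset.strongInduction with
  | H P ih =>
    rcases P.eq_empty_or_nonempty with rfl | hP
    · simp
    rw [linExt_eq_sum hP, linExt_eq_sum hP]
    have hm : minimals r P = minimals r' P := by
      ext x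
      rw [mem_minimals, mem_minimals]
      refine and_congr_right fun hx => forall₂_congr fun y hy => not_congr (h y hy x hx)
    rw [hm]
    refine Finset.sum_congr rfl fun x hx => ih _ (Finset.erase_ssubset (mem_minimals.1 hx).1) ?_
    exact fun a ha b hb => h a (Finset.mem_of_mem_erase ha) b (Finset.mem_of_mem_erase hb)

theorem linExt_map (f : ℕ ↪ ℕ) (r : ℕ → ℕ → Prop) (P : Finset ℕ) :
    linExt r (P.map f) = linExt (fun i j => r (f i) (f j)) P := by
  induction P using Finset.strongInduction with
  | H P ih =>
    rcases P.eq_empty_or_nonempty with rfl | hP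
    · simp
    rw [linExt_eq_sum hP, linExt_eq_sum (hP.map)]
    have hm : minimals r (P.map f) = (minimals (fun i j => r (f i) (f j)) P).map f := by
      ext x
      simp only [mem_minimals, Finset.mem_map]
      constructor
      · rintro ⟨⟨a, ha, rfl⟩, h⟩
        exact ⟨a, ⟨ha, fun y hy => h _ ⟨y, hy, rfl⟩⟩, rfl⟩
      · rintro ⟨a, ⟨ha, h⟩, rfl⟩
        refine ⟨⟨a, ha, rfl⟩, ?_⟩
        rintro _ ⟨y, hy, rfl⟩
        exact h y hy
    rw [hm, Finset.sum_map]
    refine Finset.sum_congr rfl fun x hx => ?_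
    rw [← Finset.map_erase, ih _ (Finset.erase_ssubset (mem_minimals.1 hx).1)]

/-- No element of a cycle is ever minimal, so the removal process gets stuck. -/
theorem linExt_eq_zero {r : ℕ → ℕ → Prop} {P : Finset ℕ} {x y z : ℕ} (hx : x ∈ P) (hy : y ∈ P)
    (hz : z ∈ P) (hxy : r x y) (hyz : r y z) (hzx : r z x) : linExt r P = 0 := by
  induction P using Finset.strongInduction with
  | H P ih =>
    rw [linExt_eq_sum ⟨x, hx⟩]
    refine Finset.sum_eq_zero fun a ha => ?_
    obtain ⟨haP, ha⟩ := mem_minimals.1 ha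
    refine ih _ (Finset.erase_ssubset haP) (Finset.mem_erase.2 ⟨?_, hx⟩)
      (Finset.mem_erase.2 ⟨?_, hy⟩) (Finset.mem_erase.2 ⟨?_, hz⟩)
    · rintro rfl; exact ha _ hz hzx
    · rintro rfl; exact ha _ hx hxy
    · rintro rfl; exact ha _ hy hyz

theorem linExt_of_minimals_eq_singleton {r : ℕ → ℕ → Prop} {P : Finset ℕ} {x : ℕ}
    (h : minimals r P = {x}) : linExt r P = linExt r (P.erase x) := by
  have hx : x ∈ P := (mem_minimals.1 (h ▸ Finset.mem_singleton_self x)).1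
  rw [linExt_eq_sum ⟨x, hx⟩, h, Finset.sum_singleton]

theorem linExt_eq_one {r : ℕ → ℕ → Prop} {P : Finset ℕ}
    (h : ∀ x ∈ P, ∀ y ∈ P, r x y ↔ x < y) : linExt r P = 1 := by
  induction P using Finset.strongInduction with
  | H P ih =>
    rcases P.eq_empty_or_nonempty with rfl | hP
    · simp
    have hm : minimals r P = {P.min' hP} := by
      ext x
      rw [mem_minimals, Finset.mem_singleton]
      constructor
      · rintro ⟨hx, h'⟩
        have h1 := h' _ (P.min'_mem hP)
        rw [h _ (P.min'_mem hP) _ hx, not_lt] at h1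
        exact le_antisymm h1 (P.min'_le x hx)
      · rintro rfl
        refine ⟨P.min'_mem hP, fun y hy => ?_⟩
        rw [h _ hy _ (P.min'_mem hP), not_lt]
        exact P.min'_le y hy
    rw [linExt_of_minimals_eq_singleton hm]
    exact ih _ (Finset.erase_ssubset (P.min'_mem hP)) fun a ha b hb =>
      h a (Finset.mem_of_mem_erase ha) b (Finset.mem_of_mem_erase hb)

theorem minimals_union {r : ℕ → ℕ → Prop} {P Q : Finset ℕ}
    (hr : ∀ p ∈ P, ∀ q ∈ Q, ¬ r p q ∧ ¬ r q p) :
    minimals r (P ∪ Q) = minimals r P ∪ minimals r Q := by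
  ext x
  simp only [mem_minimals, Finset.mem_union]
  constructor
  · rintro ⟨hx | hx, h⟩
    · exact Or.inl ⟨hx, fun y hy => h y (Or.inl hy)⟩
    · exact Or.inr ⟨hx, fun y hy => h y (Or.inr hy)⟩
  · rintro (⟨hx, h⟩ | ⟨hx, h⟩)
    · exact ⟨Or.inl hx, fun y hy => hy.elim (h y) fun hy => (hr x hx y hy).2⟩
    · exact ⟨Or.inr hx, fun y hy => hy.elim (fun hy => (hr y hy x hx).1) (h y)⟩

theorem disjoint_minimals {r r' : ℕ → ℕ → Prop} {P Q : Finset ℕ} (h : Disjoint P Q) :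
    Disjoint (minimals r P) (minimals r' Q) :=
  Finset.disjoint_of_subset_left (fun _ hx => (mem_minimals.1 hx).1)
    (Finset.disjoint_of_subset_right (fun _ hx => (mem_minimals.1 hx).1) h)

theorem erase_union_of_mem_left {P Q : Finset ℕ} (h : Disjoint P Q) {x : ℕ} (hx : x ∈ P) :
    (P ∪ Q).erase x = P.erase x ∪ Q := by
  rw [Finset.erase_union_distrib, Finset.erase_eq_of_notMem (Finset.disjoint_left.1 h hx)]

theorem erase_union_of_mem_right {P Q : Finset ℕ} (h : Disjoint P Q) {x : ℕ} (hx : x ∈ Q) :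
    (P ∪ Q).erase x = P ∪ Q.erase x := by
  rw [Finset.erase_union_distrib, Finset.erase_eq_of_notMem (Finset.disjoint_right.1 h hx)]

/-- A disjoint union without relations between the parts: linear extensions are shuffles. -/
theorem linExt_union {r : ℕ → ℕ → Prop} {P Q : Finset ℕ} (hPQ : Disjoint P Q)
    (hr : ∀ p ∈ P, ∀ q ∈ Q, ¬ r p q ∧ ¬ r q p) :
    linExt r (P ∪ Q) = (P.card + Q.card).choose P.card * linExt r P * linExt r Q := by
  induction hn : P.card + Q.card generalizing P Q with
  | zero =>
    obtain rfl : P = ∅ := Finset.card_eq_zero.1 (by omega)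
    obtain rfl : Q = ∅ := Finset.card_eq_zero.1 (by omega)
    simp
  | succ n ih =>
    rcases P.eq_empty_or_nonempty with rfl | hP
    · simp
    rcases Q.eq_empty_or_nonempty with rfl | hQ
    · have : P.card = n + 1 := by simpa using hn
      simp [this]
    rw [linExt_eq_sum (hP.mono Finset.subset_union_left), minimals_union hr,
      Finset.sum_union (disjoint_minimals hPQ)]
    have h1 : ∀ x ∈ minimals r P, linExt r ((P ∪ Q).erase x) =
        n.choose (P.card - 1) * linExt r (P.erase x) * linExt r Q := by
      intro x hx
      have hxP := (mem_minimals.1 hx).1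
      have hc := Finset.card_erase_of_mem hxP
      have := hP.card_pos
      rw [erase_union_of_mem_left hPQ hxP, ih (Finset.disjoint_of_subset_left
        (Finset.erase_subset _ _) hPQ) (fun p hp => hr p (Finset.mem_of_mem_erase hp)) (by omega),
        hc]
    have h2 : ∀ x ∈ minimals r Q, linExt r ((P ∪ Q).erase x) =
        n.choose P.card * linExt r P * linExt r (Q.erase x) := by
      intro x hx
      have hxQ := (mem_minimals.1 hx).1
      have hc := Finset.card_erase_of_mem hxQ
      have := hQ.card_pos
      rw [erase_union_of_mem_right hPQ hxQ, ih (Finset.disjoint_of_subset_right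
        (Finset.erase_subset _ _) hPQ) (fun p hp q hq => hr p hp q (Finset.mem_of_mem_erase hq))
        (by omega)]
    rw [Finset.sum_congr rfl h1, Finset.sum_congr rfl h2, ← Finset.sum_mul, ← Finset.mul_sum,
      ← Finset.mul_sum, ← linExt_eq_sum hP, ← linExt_eq_sum hQ]
    -- The first element removed lies in `P` or in `Q`; the two counts add up by Pascal's rule.
    obtain ⟨k, hk⟩ : ∃ k, P.card = k + 1 := ⟨P.card - 1, by have := hP.card_pos; omega⟩
    rw [hk, Nat.add_sub_cancel, Nat.choose_succ_succ]
    ring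

/-! ### Replacing the part below a single element -/

/-- `x ∈ Q` lies above all of `P` for the order generated by `r`, and there are no other
relations between `P` and `Q`. The function `h` witnesses that each ascending chain in `P`
reaches `x`. -/
structure BelowAt (r : ℕ → ℕ → Prop) (P Q : Finset ℕ) (x : ℕ) (h : ℕ → ℕ) : Prop where
  not_rel : ∀ p ∈ P, ∀ q ∈ Q, ¬ r q p
  eq_of_rel : ∀ p ∈ P, ∀ q ∈ Q, r p q → q = x
  ascend : ∀ p ∈ P, r p x ∨ ∃ q ∈ P, r p q ∧ h p < h q

theorem BelowAt.erase_left {r : ℕ → ℕ → Prop} {P Q : Finset ℕ} {x : ℕ} {h : ℕ → ℕ}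
    (H : BelowAt r P Q x h) {y : ℕ} (hy : y ∈ minimals r P) : BelowAt r (P.erase y) Q x h where
  not_rel p hp := H.not_rel p (Finset.mem_of_mem_erase hp)
  eq_of_rel p hp := H.eq_of_rel p (Finset.mem_of_mem_erase hp)
  ascend p hp := by
    have hpP := Finset.mem_of_mem_erase hp
    refine (H.ascend p hpP).imp_right ?_
    rintro ⟨q, hq, hpq, hlt⟩
    refine ⟨q, Finset.mem_erase.2 ⟨?_, hq⟩, hpq, hlt⟩
    rintro rfl
    exact (mem_minimals.1 hy).2 p hpP hpq

theorem BelowAt.erase_right {r : ℕ → ℕ → Prop} {P Q : Finset ℕ} {x : ℕ} {h : ℕ → ℕ}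
    (H : BelowAt r P Q x h) (y : ℕ) : BelowAt r P (Q.erase y) x h where
  not_rel p hp q hq := H.not_rel p hp q (Finset.mem_of_mem_erase hq)
  eq_of_rel p hp q hq := H.eq_of_rel p hp q (Finset.mem_of_mem_erase hq)
  ascend := H.ascend

/-- As long as something of `P` is left, `x` is blocked: an element of `P` of maximal height cannot
ascend within `P`, so it is related to `x` directly. -/
theorem BelowAt.minimals_union {r : ℕ → ℕ → Prop} {P Q : Finset ℕ} {x : ℕ} {h : ℕ → ℕ}
    (H : BelowAt r P Q x h) (hP : P.Nonempty) :
    minimals r (P ∪ Q) = minimals r P ∪ (minimals r Q).erase x := by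
  ext y
  simp only [mem_minimals, Finset.mem_union, Finset.mem_erase]
  constructor
  · rintro ⟨hy | hy, hm⟩
    · exact Or.inl ⟨hy, fun z hz => hm z (Or.inl hz)⟩
    · refine Or.inr ⟨?_, hy, fun z hz => hm z (Or.inr hz)⟩
      rintro rfl
      obtain ⟨p, hp, hmax⟩ := P.exists_max_image h hP
      rcases H.ascend p hp with hpx | ⟨q, hq, -, hlt⟩
      · exact hm p (Or.inl hp) hpx
      · exact absurd (hmax q hq) (not_le.2 hlt)
  · rintro (⟨hy, hm⟩ | ⟨hyx, hy, hm⟩)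
    · exact ⟨Or.inl hy, fun z hz => hz.elim (hm z) (H.not_rel y hy z)⟩
    · exact ⟨Or.inr hy, fun z hz => hz.elim (fun hz hzy => hyx (H.eq_of_rel z hz y hy hzy)) (hm z)⟩

theorem linExt_eq_sum_of_belowAt {r : ℕ → ℕ → Prop} {P Q : Finset ℕ} {x : ℕ} {h : ℕ → ℕ}
    (hPQ : Disjoint P Q) (H : BelowAt r P Q x h) (hP : P.Nonempty) :
    linExt r (P ∪ Q) = ∑ y ∈ minimals r P, linExt r (P.erase y ∪ Q) +
      ∑ y ∈ (minimals r Q).erase x, linExt r (P ∪ Q.erase y) := by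
  rw [linExt_eq_sum (hP.mono Finset.subset_union_left), H.minimals_union hP,
    Finset.sum_union (Finset.disjoint_of_subset_right (Finset.erase_subset _ _)
      (disjoint_minimals hPQ))]
  congr 1
  · exact Finset.sum_congr rfl fun y hy => by
      rw [erase_union_of_mem_left hPQ (mem_minimals.1 hy).1]
  · exact Finset.sum_congr rfl fun y hy => by
      rw [erase_union_of_mem_right hPQ (mem_minimals.1 (Finset.mem_of_mem_erase hy)).1]

/-- The part below `x` only enters through its size and its number of linear extensions. -/
theorem linExt_union_mul_of_belowAt {r r' : ℕ → ℕ → Prop} {P P' Q : Finset ℕ} {x : ℕ}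
    {h h' : ℕ → ℕ} (hPQ : Disjoint P Q) (hPQ' : Disjoint P' Q) (hcard : P.card = P'.card)
    (H : BelowAt r P Q x h) (H' : BelowAt r' P' Q x h')
    (hQ : ∀ a ∈ Q, ∀ b ∈ Q, r a b ↔ r' a b) :
    linExt r (P ∪ Q) * linExt r' P' = linExt r' (P' ∪ Q) * linExt r P := by
  induction hn : P.card + Q.card generalizing P P' Q with
  | zero =>
    obtain rfl : P = ∅ := Finset.card_eq_zero.1 (by omega)
    obtain rfl : P' = ∅ := Finset.card_eq_zero.1 (by omega)
    obtain rfl : Q = ∅ := Finset.card_eq_zero.1 (by omega)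
    simp
  | succ n ih =>
    rcases P.eq_empty_or_nonempty with rfl | hP
    · obtain rfl : P' = ∅ := Finset.card_eq_zero.1 (by rw [← hcard, Finset.card_empty])
      simp [linExt_congr hQ]
    have hP' : P'.Nonempty := Finset.card_pos.1 (hcard ▸ hP.card_pos)
    have hm : minimals r Q = minimals r' Q := by
      ext x
      rw [mem_minimals, mem_minimals]
      refine and_congr_right fun hx => forall₂_congr fun y hy => not_congr (hQ y hy x hx)
    rw [linExt_eq_sum_of_belowAt hPQ H hP, linExt_eq_sum_of_belowAt hPQ' H' hP', add_mul, add_mul,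
      hm]
    congr 1
    -- The cross-multiplied form replaces a quotient: both sides become double sums over first
    -- removals from `P` and `P'`, matched term by term.
    · rw [linExt_eq_sum hP, linExt_eq_sum hP', Finset.sum_mul_sum, Finset.sum_mul_sum,
        Finset.sum_comm]
      refine Finset.sum_congr rfl fun y' hy' => Finset.sum_congr rfl fun y hy => ?_
      have hyP := (mem_minimals.1 hy).1
      have hyP' := (mem_minimals.1 hy').1
      have c1 := Finset.card_erase_of_mem hyP
      have c2 := Finset.card_erase_of_mem hyP'
      have := hP.card_pos
      exact ih (Finset.disjoint_of_subset_left (Finset.erase_subset _ _) hPQ)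
        (Finset.disjoint_of_subset_left (Finset.erase_subset _ _) hPQ') (by omega)
        (H.erase_left hy) (H'.erase_left hy') hQ (by omega)
    · rw [Finset.sum_mul, Finset.sum_mul]
      refine Finset.sum_congr rfl fun y hy => ?_
      have hyQ := (mem_minimals.1 (Finset.mem_of_mem_erase hy)).1
      have c1 := Finset.card_erase_of_mem hyQ
      have := Finset.card_pos.2 ⟨y, hyQ⟩
      exact ih (Finset.disjoint_of_subset_right (Finset.erase_subset _ _) hPQ)
        (Finset.disjoint_of_subset_right (Finset.erase_subset _ _) hPQ') hcard
        (H.erase_right y) (H'.erase_right y)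
        (fun a ha b hb => hQ a (Finset.mem_of_mem_erase ha) b (Finset.mem_of_mem_erase hb))
        (by omega)

/-! ### Permutations as linear extensions -/

theorem exists_finset_lists_card_eq_linExt (r : ℕ → ℕ → Prop) (hr : ∀ x, ¬ r x x) (P : Finset ℕ) :
    ∃ A : Finset (List ℕ),
      (∀ l, l ∈ A ↔ l.Nodup ∧ l.toFinset = P ∧ l.Pairwise fun a b => ¬ r b a) ∧
        A.card = linExt r P := by
  induction P using Finset.strongInduction with
  | H P ih =>
    rcases P.eq_empty_or_nonempty with rfl | hP
    · refine ⟨{[]}, fun l => ?_, by simp⟩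
      rw [Finset.mem_singleton, List.toFinset_eq_empty_iff]
      exact ⟨by rintro rfl; simp, fun h => h.2.1⟩
    choose! A hA hcard using fun x (hx : x ∈ P) => ih _ (Finset.erase_ssubset hx)
    refine ⟨(minimals r P).biUnion fun x => (A x).map ⟨List.cons x, List.cons_injective⟩,
      fun l => ?_, ?_⟩
    · simp only [Finset.mem_biUnion, Finset.mem_map, Function.Embedding.coeFn_mk]
      constructor
      · rintro ⟨x, hx, l, hl, rfl⟩
        obtain ⟨hxP, hx⟩ := mem_minimals.1 hx
        obtain ⟨h1, h2, h3⟩ := (hA x hxP l).1 hl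
        refine ⟨List.nodup_cons.2 ⟨?_, h1⟩, ?_, List.pairwise_cons.2 ⟨?_, h3⟩⟩
        · rw [← List.mem_toFinset, h2]; simp
        · rw [List.toFinset_cons, h2, Finset.insert_erase hxP]
        · intro b hb
          rw [← List.mem_toFinset, h2] at hb
          exact hx b (Finset.mem_of_mem_erase hb)
      · rintro ⟨h1, h2, h3⟩
        cases l with
        | nil => simp at h2; simp [← h2] at hP
        | cons x l =>
          rw [List.nodup_cons] at h1
          rw [List.pairwise_cons] at h3
          rw [List.toFinset_cons] at h2
          have hxP : x ∈ P := h2 ▸ Finset.mem_insert_self _ _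
          refine ⟨x, mem_minimals.2 ⟨hxP, ?_⟩, l, (hA x hxP l).2 ⟨h1.2, ?_, h3.2⟩, rfl⟩
          · intro y hy
            rw [← h2, Finset.mem_insert, List.mem_toFinset] at hy
            rcases hy with rfl | hy
            · exact hr y
            · exact h3.1 y hy
          · rw [← h2, Finset.erase_insert (by simpa using h1.1)]
    · rw [Finset.card_biUnion, linExt_eq_sum hP]
      · refine Finset.sum_congr rfl fun x hx => ?_
        rw [Finset.card_map, hcard x (mem_minimals.1 hx).1]
      · intro x _ y _ hxy
        rw [Function.onFun, Finset.disjoint_left]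
        intro l hl hl'
        simp only [Finset.mem_map, Function.Embedding.coeFn_mk] at hl hl'
        obtain ⟨l₁, -, rfl⟩ := hl
        obtain ⟨l₂, -, h⟩ := hl'
        exact hxy (List.cons.inj h).1.symm

open Classical in
theorem card_perm_eq_linExt (r : ℕ → ℕ → Prop) (hr : ∀ x, ¬ r x x) (n : ℕ) :
    (Finset.univ.filter fun π : Equiv.Perm (Fin n) => ∀ i j : Fin n, r i j → π i < π j).card =
      linExt r (Finset.range n) := by
  obtain ⟨A, hA, hcard⟩ := exists_finset_lists_card_eq_linExt r hr (Finset.range n)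
  rw [← hcard]
  -- `π` corresponds to the list of positions in order of increasing entry.
  refine Finset.card_bij (fun π _ => List.ofFn fun i => (π.symm i : ℕ)) ?_ ?_ ?_
  · intro π hπ
    rw [Finset.mem_filter] at hπ
    refine (hA _).2 ⟨?_, ?_, ?_⟩
    · exact List.nodup_ofFn.2 (Fin.val_injective.comp π.symm.injective)
    · ext a
      simp only [List.mem_toFinset, List.mem_ofFn, Finset.mem_range]
      constructor
      · rintro ⟨i, rfl⟩; exact (π.symm i).2
      · intro ha; exact ⟨π ⟨a, ha⟩, by simp⟩
    · rw [List.pairwise_ofFn]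
      intro i j hij h
      have := hπ.2 _ _ h
      simp only [Equiv.apply_symm_apply] at this
      exact lt_asymm hij this
  · intro π _ ρ _ h
    have h := List.ofFn_injective h
    have : π.symm = ρ.symm := Equiv.ext fun i => Fin.ext (congrFun h i)
    simpa using congrArg Equiv.symm this
  · intro l hl
    obtain ⟨h1, h2, h3⟩ := (hA l).1 hl
    have hlen : l.length = n := by
      rw [← List.toFinset_card_of_nodup h1, h2, Finset.card_range]
    subst hlen
    have hmem : ∀ i : Fin l.length, l.get i < l.length := fun i => by
      rw [← Finset.mem_range, ← h2, List.mem_toFinset]; exact l.get_mem i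
    have hinj : Function.Injective fun i : Fin l.length => (⟨l.get i, hmem i⟩ : Fin l.length) :=
      fun i j h => List.nodup_iff_injective_get.1 h1 (Fin.mk.inj h)
    set e : Equiv.Perm (Fin l.length) := Equiv.ofBijective _ (Finite.injective_iff_bijective.1 hinj)
      with he
    have hval : ∀ i, (e i : ℕ) = l.get i := fun i => rfl
    refine ⟨e.symm, ?_, ?_⟩
    · rw [Finset.mem_filter]
      refine ⟨Finset.mem_univ _, fun i j hij => ?_⟩
      obtain ⟨a, rfl⟩ := e.surjective i
      obtain ⟨b, rfl⟩ := e.surjective j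
      simp only [Equiv.symm_apply_apply]
      rw [hval, hval] at hij
      by_contra hlt
      rcases (not_lt.1 hlt).eq_or_lt with rfl | hlt
      · exact hr _ hij
      · exact List.pairwise_iff_get.1 h3 b a hlt hij
    · simp only [Equiv.symm_symm, hval]
      exact List.ofFn_get l

/-! ### Marked occurrences of the pattern -/

/-- The relation imposed on positions by requiring the entries in positions `0, …, m` to increase
and the pattern `1324` to occur at each of the positions in `S`. -/
def clusterRel (m : ℕ) (S : Finset ℕ) (i j : ℕ) : Prop :=
  (i < j ∧ j ≤ m) ∨
    ∃ s ∈ S, (i = s ∧ j = s + 2) ∨ (i = s + 2 ∧ j = s + 1) ∨ (i = s + 1 ∧ j = s + 3)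

theorem clusterRel_irrefl (m : ℕ) (S : Finset ℕ) (x : ℕ) : ¬ clusterRel m S x x := by
  rintro (h | ⟨s, -, h⟩) <;> omega

theorem occursAt_pattern1324_iff {n : ℕ} (π : Equiv.Perm (Fin n)) (i : ℕ) :
    OccursAt pattern1324 π i ↔ ∃ h : i + 4 ≤ n, π ⟨i, by omega⟩ < π ⟨i + 2, by omega⟩ ∧
      π ⟨i + 2, by omega⟩ < π ⟨i + 1, by omega⟩ ∧ π ⟨i + 1, by omega⟩ < π ⟨i + 3, by omega⟩ := by
  refine exists_congr fun h => ?_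
  constructor
  · intro H
    exact ⟨(H 0 2).2 (by decide), (H 2 1).2 (by decide), (H 1 3).2 (by decide)⟩
  · rintro ⟨h1, h2, h3⟩ a b
    have h4 := h1.trans h2
    have h5 := h2.trans h3
    have h6 := h4.trans h3
    fin_cases a <;> fin_cases b <;>
      simp [pattern1324, h1, h2, h3, h4, h5, h6, h1.le, h2.le, h3.le, h4.le, h5.le, h6.le]

theorem forall_clusterRel_iff {n : ℕ} (π : Equiv.Perm (Fin n)) {S : Finset ℕ}
    (hS : S ⊆ Finset.Ico 0 (n - 3)) :
    (∀ i j : Fin n, clusterRel 0 S i j → π i < π j) ↔ ∀ s ∈ S, OccursAt pattern1324 π s := by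
  constructor
  · intro H s hs
    have := Finset.mem_Ico.1 (hS hs)
    refine (occursAt_pattern1324_iff π s).2 ⟨by omega, H _ _ (Or.inr ⟨s, hs, Or.inl ?_⟩),
      H _ _ (Or.inr ⟨s, hs, Or.inr (Or.inl ?_)⟩), H _ _ (Or.inr ⟨s, hs, Or.inr (Or.inr ?_)⟩)⟩ <;>
      simp
  · rintro H ⟨i, hi⟩ ⟨j, hj⟩ (h | ⟨s, hs, h⟩)
    · omega
    · obtain ⟨h0, h1, h2, h3⟩ := (occursAt_pattern1324_iff π s).1 (H s hs)
      dsimp only at h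
      rcases h with ⟨rfl, rfl⟩ | ⟨rfl, rfl⟩ | ⟨rfl, rfl⟩
      exacts [h1, h2, h3]

/-- The weighted count of pairs of a permutation of `{0, …, N - 1}` that starts with an increasing
run on positions `0, …, m` and a set of marked occurrences of `1324` at positions `≥ m`. -/
noncomputable def markedSum {R : Type*} [CommRing R] (t : R) (m N : ℕ) : R :=
  ∑ S ∈ (Finset.Ico m (N - 3)).powerset, t ^ S.card * (linExt (clusterRel m S) (Finset.range N) : R)

/-- `(t + 1) ^ c` is the sum of `t ^ |S|` over subsets `S` of the set of occurrences; exchanging the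
sums leaves, for each `S`, a count of linear extensions. -/
theorem sum_pow_occurrences {R : Type*} [CommRing R] (t : R) (n : ℕ) :
    ∑ π : Equiv.Perm (Fin n), (t + 1) ^ occurrences pattern1324 π = markedSum t 0 n := by
  classical
  have h1 : ∀ π : Equiv.Perm (Fin n), (t + 1) ^ occurrences pattern1324 π =
      ∑ S ∈ (Finset.Ico 0 (n - 3)).powerset,
        if (∀ i j : Fin n, clusterRel 0 S i j → π i < π j) then t ^ S.card else 0 := by
    intro π
    rw [occurrences, ← Finset.sum_pow_mul_eq_add_pow, ← Finset.sum_filter]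
    refine Finset.sum_congr ?_ (by simp)
    ext S
    simp only [Finset.mem_powerset, Finset.mem_filter]
    constructor
    · intro h
      have hS : S ⊆ Finset.Ico 0 (n - 3) := fun s hs => by
        obtain ⟨hn, -⟩ := (Finset.mem_filter.1 (h hs)).2
        rw [Finset.mem_Ico]; omega
      exact ⟨hS, (forall_clusterRel_iff π hS).2 fun s hs => (Finset.mem_filter.1 (h hs)).2⟩
    · rintro ⟨hS, h⟩ s hs
      have := Finset.mem_Ico.1 (hS hs)
      exact Finset.mem_filter.2 ⟨Finset.mem_range.2 (by omega),
        (forall_clusterRel_iff π hS).1 h s hs⟩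
  rw [Finset.sum_congr rfl fun π _ => h1 π, Finset.sum_comm, markedSum]
  refine Finset.sum_congr rfl fun S _ => ?_
  rw [← card_perm_eq_linExt _ (clusterRel_irrefl 0 S), ← Finset.sum_filter, Finset.sum_const,
    nsmul_eq_mul, mul_comm]

/-! ### Blocks of marks and Catalan numbers -/

/-- The `k` positions `m, m + 2, …, m + 2 (k - 1)`. -/
def blockSet (m k : ℕ) : Finset ℕ := (Finset.range k).image fun i => m + 2 * i

theorem mem_blockSet {m k s : ℕ} : s ∈ blockSet m k ↔ ∃ i < k, s = m + 2 * i := by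
  simp [blockSet, eq_comm]

theorem clusterRel_blockSet_iff {m k i j : ℕ} {S : Finset ℕ} :
    clusterRel m (blockSet m k ∪ S) i j ↔ (i < j ∧ j ≤ m) ∨
      (∃ e < k, (i = m + 2 * e ∧ j = m + 2 * e + 2) ∨
        (i = m + 2 * e + 2 ∧ j = m + 2 * e + 1) ∨ (i = m + 2 * e + 1 ∧ j = m + 2 * e + 3)) ∨
      ∃ s ∈ S, (i = s ∧ j = s + 2) ∨ (i = s + 2 ∧ j = s + 1) ∨ (i = s + 1 ∧ j = s + 3) := by
  refine or_congr_right ⟨?_, ?_⟩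
  · rintro ⟨s, hs, h⟩
    rcases Finset.mem_union.1 hs with hs | hs
    · obtain ⟨e, he, rfl⟩ := mem_blockSet.1 hs
      exact Or.inl ⟨e, he, h⟩
    · exact Or.inr ⟨s, hs, h⟩
  · rintro (⟨e, he, h⟩ | ⟨s, hs, h⟩)
    · exact ⟨_, Finset.mem_union_left _ (mem_blockSet.2 ⟨e, he, rfl⟩), h⟩
    · exact ⟨s, Finset.mem_union_right _ hs, h⟩

/-- What is left of the two rows `m + 2, m + 4, …, m + 2 k` and `m + 1, m + 3, …, m + 2 k - 1`
after removing the first `i` elements of the former and the first `j` elements of the latter. -/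
def twoRows (m k i j : ℕ) : Finset ℕ :=
  (Finset.range (m + 2 * k + 1)).filter fun p =>
    m < p ∧ (p % 2 = m % 2 → m + 2 * i < p) ∧ (p % 2 ≠ m % 2 → m + 2 * j < p)

theorem mem_twoRows {m k i j p : ℕ} : p ∈ twoRows m k i j ↔ p < m + 2 * k + 1 ∧ m < p ∧
    (p % 2 = m % 2 → m + 2 * i < p) ∧ (p % 2 ≠ m % 2 → m + 2 * j < p) := by
  simp [twoRows]

/-- Each `m + 2 * l + 1` waits for `m + 2 * l + 2`, so the second row never gets ahead of the first:
these are the rules for filling a two-row standard Young tableau. -/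
theorem mem_minimals_twoRows {m k i j x : ℕ} {S : Finset ℕ} (hS : ∀ s ∈ S, m + 2 * k + 1 ≤ s)
    (hik : i ≤ k) (hji : j ≤ i) :
    x ∈ minimals (clusterRel m (blockSet m k ∪ S)) (twoRows m k i j) ↔
      (x = m + 2 * i + 2 ∧ i < k) ∨ (x = m + 2 * j + 1 ∧ j < i) := by
  simp only [mem_minimals, clusterRel_blockSet_iff]
  constructor
  · rintro ⟨hx, h⟩
    rw [mem_twoRows] at hx
    by_cases hp : x % 2 = m % 2
    · by_contra hne
      obtain ⟨l, hl⟩ : ∃ l, x = m + 2 * l + 2 := ⟨(x - m) / 2 - 1, by omega⟩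
      exact h (x - 2) (mem_twoRows.2 (by omega)) (Or.inr (Or.inl ⟨l, by omega, by omega⟩))
    · obtain ⟨l, hl⟩ : ∃ l, x = m + 2 * l + 1 := ⟨(x - m) / 2, by omega⟩
      by_contra hne
      by_cases hil : i < l + 1
      · exact h (x + 1) (mem_twoRows.2 (by omega)) (Or.inr (Or.inl ⟨l, by omega, by omega⟩))
      · exact h (x - 2) (mem_twoRows.2 (by omega)) (Or.inr (Or.inl ⟨l - 1, by omega, by omega⟩))
  · intro hx
    refine ⟨mem_twoRows.2 (by omega), fun y hy => ?_⟩
    rw [mem_twoRows] at hy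
    rintro (h | ⟨e, he, h⟩ | ⟨s, hs, h⟩)
    · omega
    · omega
    · have := hS s hs
      omega

/-- With `p` and `q` elements left in the rows the count is the ballot number `C(p+q, q) - C(p+q,
q+1)`, written without subtraction. The two possible removals give Pascal's rule; for `p = q` only
the first row can be shortened, and the symmetry of binomials takes over. -/
theorem linExt_twoRows {m k : ℕ} {S : Finset ℕ} (hS : ∀ s ∈ S, m + 2 * k + 1 ≤ s) (p q : ℕ)
    (hpq : p ≤ q) (hq : q ≤ k) :
    linExt (clusterRel m (blockSet m k ∪ S)) (twoRows m k (k - p) (k - q)) +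
      (p + q).choose (q + 1) = (p + q).choose q := by
  induction hn : p + q generalizing p q with
  | zero =>
    have h0 : twoRows m k (k - p) (k - q) = ∅ := by
      rw [Finset.eq_empty_iff_forall_notMem]
      intro x hx
      rw [mem_twoRows] at hx
      omega
    obtain rfl : q = 0 := by omega
    rw [h0]
    simp
  | succ n ih =>
    have hmin : ∀ x, _ ↔ _ := fun x =>
      mem_minimals_twoRows (x := x) hS (Nat.sub_le k p) (by omega : k - q ≤ k - p)
    have hne : (twoRows m k (k - p) (k - q)).Nonempty := by
      refine ⟨m + 2 * k - 1, mem_twoRows.2 ?_⟩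
      omega
    have ea : 0 < p → (twoRows m k (k - p) (k - q)).erase (m + 2 * (k - p) + 2) =
        twoRows m k (k - (p - 1)) (k - q) := by
      intro hp
      ext x
      rw [Finset.mem_erase, mem_twoRows, mem_twoRows]
      omega
    have eb : (twoRows m k (k - p) (k - q)).erase (m + 2 * (k - q) + 1) =
        twoRows m k (k - p) (k - (q - 1)) := by
      ext x
      rw [Finset.mem_erase, mem_twoRows, mem_twoRows]
      omega
    rcases Nat.eq_zero_or_pos p with rfl | hp
    · have hm : minimals (clusterRel m (blockSet m k ∪ S)) (twoRows m k (k - 0) (k - q)) =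
          {m + 2 * (k - q) + 1} := by
        ext x; rw [hmin, Finset.mem_singleton]; omega
      have := ih 0 (q - 1) (by omega) (by omega) (by omega)
      obtain rfl : q = n + 1 := by omega
      rw [linExt_of_minimals_eq_singleton hm, eb]
      simp only [Nat.add_sub_cancel, Nat.choose_succ_self, Nat.choose_self] at this ⊢
      exact this
    · rcases hpq.eq_or_lt with rfl | hlt
      · have hm : minimals (clusterRel m (blockSet m k ∪ S)) (twoRows m k (k - p) (k - p)) =
            {m + 2 * (k - p) + 2} := by
          ext x; rw [hmin, Finset.mem_singleton]; omega
        have := ih (p - 1) p (by omega) (by omega) (by omega)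
        rw [linExt_of_minimals_eq_singleton hm, ea hp]
        obtain ⟨d, rfl⟩ : ∃ d, p = d + 1 := ⟨p - 1, by omega⟩
        have hsymm : n.choose d = n.choose (d + 1) := by
          rw [show n = 2 * d + 1 by omega, Nat.choose_symm_half]
        rw [Nat.choose_succ_succ n (d + 1), Nat.choose_succ_succ n d, hsymm]
        simp only [Nat.succ_eq_add_one] at this ⊢
        omega
      · have hm : minimals (clusterRel m (blockSet m k ∪ S)) (twoRows m k (k - p) (k - q)) =
            {m + 2 * (k - p) + 2, m + 2 * (k - q) + 1} := by
          ext x; rw [hmin, Finset.mem_insert, Finset.mem_singleton]; omega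
        have h1 := ih (p - 1) q (by omega) (by omega) (by omega)
        have h2 := ih p (q - 1) (by omega) (by omega) (by omega)
        rw [linExt_eq_sum hne, hm, Finset.sum_pair (by omega), ea hp, eb]
        obtain ⟨d, rfl⟩ : ∃ d, q = d + 1 := ⟨q - 1, by omega⟩
        rw [Nat.choose_succ_succ n (d + 1), Nat.choose_succ_succ n d]
        simp only [Nat.succ_eq_add_one, Nat.add_sub_cancel] at h1 h2 ⊢
        omega

theorem linExt_block {m k : ℕ} {S : Finset ℕ} (hS : ∀ s ∈ S, m + 2 * k + 1 ≤ s) :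
    linExt (clusterRel m (blockSet m k ∪ S)) (Finset.range (m + 2 * k + 1)) = catalan k := by
  -- The run `0, …, m` lies below everything else, so it is removed first and in order.
  have hchain : ∀ d ≤ m + 1, linExt (clusterRel m (blockSet m k ∪ S))
      (Finset.range (m + 2 * k + 1)) =
        linExt (clusterRel m (blockSet m k ∪ S)) (Finset.Ico d (m + 2 * k + 1)) := by
    intro d
    induction d with
    | zero => intro _; rw [Finset.range_eq_Ico]
    | succ d ih =>
      intro hd
      have hm : minimals (clusterRel m (blockSet m k ∪ S)) (Finset.Ico d (m + 2 * k + 1)) =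
          {d} := by
        ext x
        simp only [mem_minimals, Finset.mem_singleton, clusterRel_blockSet_iff, Finset.mem_Ico]
        constructor
        · rintro ⟨hx, h⟩
          by_contra hne
          rcases le_or_gt x m with hxm | hxm
          · exact h d (by omega) (Or.inl (by omega))
          · by_cases hp : x % 2 = m % 2
            · exact h (x - 2) (by omega)
                (Or.inr (Or.inl ⟨(x - m) / 2 - 1, by omega, by omega⟩))
            · exact h (x + 1) (by omega) (Or.inr (Or.inl ⟨(x - m) / 2, by omega, by omega⟩))
        · rintro rfl
          refine ⟨by omega, fun y hy => ?_⟩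
          rintro (h | ⟨e, he, h⟩ | ⟨s, hs, h⟩)
          · omega
          · omega
          · have := hS s hs
            omega
      rw [ih (by omega), linExt_of_minimals_eq_singleton hm]
      congr 1
      ext x
      simp only [Finset.mem_erase, Finset.mem_Ico]
      omega
  have hrows : Finset.Ico (m + 1) (m + 2 * k + 1) = twoRows m k (k - k) (k - k) := by
    ext x
    rw [Finset.mem_Ico, mem_twoRows]
    omega
  have h := linExt_twoRows hS k k le_rfl le_rfl
  rw [hchain _ le_rfl, hrows]
  have h1 := succ_mul_catalan_eq_centralBinom k
  have h2 := Nat.choose_succ_right_eq (k + k) k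
  rw [Nat.centralBinom, two_mul] at h1
  rw [Nat.add_sub_cancel] at h2
  refine Nat.eq_of_mul_eq_mul_left (Nat.succ_pos k) ?_
  have h3 := congrArg (· * (k + 1)) h
  simp only [add_mul] at h3
  rw [h2] at h3
  rw [Nat.succ_eq_add_one, h1]
  linarith

/-- All positions before `m + 2 * k + 1` lie below that one and have no other link to the rest. A
chain on them has one linear extension instead of `catalan k`, which is the factor lost in the
exchange. -/
theorem linExt_of_block {m k N : ℕ} {S : Finset ℕ} (hk : 0 < k) (hN : m + 2 * k + 1 < N)
    (hS : ∀ s ∈ S, m + 2 * k + 1 ≤ s) :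
    linExt (clusterRel m (blockSet m k ∪ S)) (Finset.range N) =
      catalan k * linExt (clusterRel (m + 2 * k + 1) S) (Finset.range N) := by
  have hsplit : Finset.range N = Finset.range (m + 2 * k + 1) ∪ Finset.Ico (m + 2 * k + 1) N := by
    ext x
    simp only [Finset.mem_union, Finset.mem_range, Finset.mem_Ico]
    omega
  have hdisj : Disjoint (Finset.range (m + 2 * k + 1)) (Finset.Ico (m + 2 * k + 1) N) := by
    rw [Finset.disjoint_left]
    intro x hx hx'
    simp only [Finset.mem_range, Finset.mem_Ico] at hx hx'
    omega
  -- Ascending paths follow the run, pass to the row `m + 2, m + 4, …`, cross to the row `m + 1, m +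
  -- 3, …` and end at `m + 2 * k + 1`. Adding `N` to the height puts the last row above the others.
  have H : BelowAt (clusterRel m (blockSet m k ∪ S)) (Finset.range (m + 2 * k + 1))
      (Finset.Ico (m + 2 * k + 1) N) (m + 2 * k + 1)
      (fun p => if p ≤ m ∨ p % 2 = m % 2 then p else p + N) := by
    constructor
    · intro p hp q hq
      rw [Finset.mem_range] at hp
      rw [Finset.mem_Ico] at hq
      rw [clusterRel_blockSet_iff]
      rintro (h | ⟨e, he, h⟩ | ⟨s, hs, h⟩)
      · omega
      · omega
      · have := hS s hs
        omega
    · intro p hp q hq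
      rw [Finset.mem_range] at hp
      rw [Finset.mem_Ico] at hq
      rw [clusterRel_blockSet_iff]
      rintro (h | ⟨e, he, h⟩ | ⟨s, hs, h⟩)
      · omega
      · omega
      · have := hS s hs
        omega
    · intro p hp
      rw [Finset.mem_range] at hp
      simp only [clusterRel_blockSet_iff, Finset.mem_range]
      rcases lt_trichotomy p m with hpm | rfl | hpm
      · refine Or.inr ⟨p + 1, by omega, Or.inl (by omega), ?_⟩
        rw [if_pos (by omega), if_pos (by omega)]
        omega
      · refine Or.inr ⟨p + 2, by omega, Or.inr (Or.inl ⟨0, by omega, by omega⟩), ?_⟩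
        rw [if_pos (by omega), if_pos (by omega)]
        omega
      · by_cases hpar : p % 2 = m % 2
        · refine Or.inr ⟨p - 1, by omega,
            Or.inr (Or.inl ⟨(p - m) / 2 - 1, by omega, by omega⟩), ?_⟩
          rw [if_pos (by omega), if_neg (by omega)]
          omega
        · by_cases hlast : p + 2 = m + 2 * k + 1
          · exact Or.inl (Or.inr (Or.inl ⟨(p - m) / 2, by omega, by omega⟩))
          · refine Or.inr ⟨p + 2, by omega,
              Or.inr (Or.inl ⟨(p - m) / 2, by omega, by omega⟩), ?_⟩
            rw [if_neg (by omega), if_neg (by omega)]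
            omega
  have H' : BelowAt (clusterRel (m + 2 * k + 1) S) (Finset.range (m + 2 * k + 1))
      (Finset.Ico (m + 2 * k + 1) N) (m + 2 * k + 1) id := by
    constructor
    · intro p hp q hq
      rw [Finset.mem_range] at hp
      rw [Finset.mem_Ico] at hq
      rintro (h | ⟨s, hs, h⟩)
      · omega
      · have := hS s hs
        omega
    · intro p hp q hq
      rw [Finset.mem_range] at hp
      rw [Finset.mem_Ico] at hq
      rintro (h | ⟨s, hs, h⟩)
      · omega
      · have := hS s hs
        omega
    · intro p hp
      rw [Finset.mem_range] at hp
      exact Or.inl (Or.inl (by omega))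
  have hQ : ∀ a ∈ Finset.Ico (m + 2 * k + 1) N, ∀ b ∈ Finset.Ico (m + 2 * k + 1) N,
      clusterRel m (blockSet m k ∪ S) a b ↔ clusterRel (m + 2 * k + 1) S a b := by
    intro a ha b hb
    rw [Finset.mem_Ico] at ha hb
    rw [clusterRel_blockSet_iff]
    constructor
    · rintro (h | ⟨e, he, h⟩ | h)
      · omega
      · omega
      · exact Or.inr h
    · rintro (h | h)
      · omega
      · exact Or.inr (Or.inr h)
  have h1 : linExt (clusterRel (m + 2 * k + 1) S) (Finset.range (m + 2 * k + 1)) = 1 := by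
    refine linExt_eq_one fun a ha b hb => ?_
    rw [Finset.mem_range] at ha hb
    constructor
    · rintro (h | ⟨s, hs, h⟩)
      · exact h.1
      · have := hS s hs
        omega
    · exact fun h => Or.inl ⟨h, hb.le⟩
  have := linExt_union_mul_of_belowAt hdisj hdisj rfl H H' hQ
  rw [h1, mul_one, linExt_block hS, ← hsplit] at this
  rw [this, mul_comm]

/-! ### Decomposing marked permutations by their first block -/

section

theorem sum_powerset_Ico {M : Type*} [AddCommMonoid M] (f : Finset ℕ → M) {a b : ℕ} (h : a < b) :
    ∑ S ∈ (Finset.Ico a b).powerset, f S = ∑ S ∈ (Finset.Ico (a + 1) b).powerset, f S +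
      ∑ S ∈ (Finset.Ico (a + 1) b).powerset, f (insert a S) := by
  rw [← Finset.insert_Ico_add_one_left_eq_Ico h, Finset.sum_powerset_insert (by simp)]

/-- The mark at `s` puts position `s + 2` below `s + 1` and `s + 1` below `s + 3`, while the mark at
`s + 1` puts `s + 3` below `s + 2`. -/
theorem linExt_clusterRel_eq_zero {m N s : ℕ} {S : Finset ℕ} (h : s ∈ S) (h' : s + 1 ∈ S)
    (hN : s + 3 < N) : linExt (clusterRel m S) (Finset.range N) = 0 :=
  linExt_eq_zero (x := s + 1) (y := s + 3) (z := s + 2) (Finset.mem_range.2 (by omega))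
    (Finset.mem_range.2 (by omega)) (Finset.mem_range.2 (by omega))
    (Or.inr ⟨s, h, by omega⟩) (Or.inr ⟨s + 1, h', by omega⟩) (Or.inr ⟨s, h, by omega⟩)

variable {R : Type*} [CommRing R]

/-- The part of `markedSum t m N` in which all of `m, m + 2, …, m + 2 (k - 1)` are marked. -/
noncomputable def blockSum (t : R) (m N k : ℕ) : R :=
  ∑ S ∈ (Finset.Ico (m + 2 * k) (N - 3)).powerset,
    t ^ (k + S.card) * (linExt (clusterRel m (blockSet m k ∪ S)) (Finset.range N) : R)

/-- The part of `blockSum t m N k` in which `m + 2 k` is not marked. -/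
noncomputable def lastBlockSum (t : R) (m N k : ℕ) : R :=
  ∑ S ∈ (Finset.Ico (m + 2 * k + 1) (N - 3)).powerset,
    t ^ (k + S.card) * (linExt (clusterRel m (blockSet m k ∪ S)) (Finset.range N) : R)

theorem blockSum_zero (t : R) (m N : ℕ) : blockSum t m N 0 = markedSum t m N := by
  simp [blockSum, markedSum, blockSet]

theorem blockSet_succ (m k : ℕ) : blockSet m (k + 1) = insert (m + 2 * k) (blockSet m k) := by
  rw [blockSet, Finset.range_add_one, Finset.image_insert, blockSet]

theorem blockSum_eq_add {t : R} {m N k : ℕ} (h : m + 2 * k + 3 < N) :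
    blockSum t m N k = lastBlockSum t m N k + blockSum t m N (k + 1) := by
  rw [blockSum, sum_powerset_Ico _ (by omega), lastBlockSum]
  congr 1
  have key : ∀ S ∈ (Finset.Ico (m + 2 * (k + 1)) (N - 3)).powerset,
      t ^ (k + (insert (m + 2 * k) S).card) * (linExt (clusterRel m (blockSet m k ∪
        insert (m + 2 * k) S)) (Finset.range N) : R) = t ^ (k + 1 + S.card) *
          (linExt (clusterRel m (blockSet m (k + 1) ∪ S)) (Finset.range N) : R) := by
    intro S hS
    rw [Finset.mem_powerset] at hS
    rw [Finset.card_insert_of_notMem, blockSet_succ, Finset.union_insert, Finset.insert_union]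
    · congr 2
      omega
    · intro hmem
      have := Finset.mem_Ico.1 (hS hmem)
      omega
  rw [blockSum, ← Finset.sum_congr rfl key]
  rcases lt_or_ge (m + 2 * k + 1) (N - 3) with hlt | hge
  -- Once `m + 2 * k` is marked, sets that also mark `m + 2 * k + 1` contribute nothing.
  · rw [sum_powerset_Ico _ hlt, show m + 2 * (k + 1) = m + 2 * k + 1 + 1 by ring, add_eq_left]
    refine Finset.sum_eq_zero fun S _ => ?_
    rw [linExt_clusterRel_eq_zero (s := m + 2 * k) (by simp) (by simp) h, Nat.cast_zero, mul_zero]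
  · rw [Finset.Ico_eq_empty (by omega), Finset.Ico_eq_empty (by omega)]

theorem blockSum_eq_last {t : R} {m N k : ℕ} (h : N ≤ m + 2 * k + 3) :
    blockSum t m N k = lastBlockSum t m N k := by
  rw [blockSum, lastBlockSum, Finset.Ico_eq_empty (by omega), Finset.Ico_eq_empty (by omega)]

theorem lastBlockSum_of_pos {t : R} {m N k : ℕ} (hk : 0 < k) (h : m + 2 * k + 1 < N) :
    lastBlockSum t m N k = catalan k * t ^ k * markedSum t (m + 2 * k + 1) N := by
  rw [lastBlockSum, markedSum, Finset.mul_sum]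
  refine Finset.sum_congr rfl fun S hS => ?_
  rw [linExt_of_block hk h fun s hs => (Finset.mem_Ico.1 (Finset.mem_powerset.1 hS hs)).1]
  push_cast
  ring

/-- With no mark touching the run, it is a chain shuffled freely with the remaining positions, which
are shifted back to start at 0. -/
theorem linExt_of_isolated {m N : ℕ} (hm : m < N) (S : Finset ℕ) :
    linExt (clusterRel m (S.map (addRightEmbedding (m + 1)))) (Finset.range N) =
      N.choose (m + 1) * linExt (clusterRel 0 S) (Finset.range (N - (m + 1))) := by
  have hsplit : Finset.range N = Finset.range (m + 1) ∪
      (Finset.range (N - (m + 1))).map (addRightEmbedding (m + 1)) := by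
    ext x
    simp only [Finset.mem_union, Finset.mem_range, Finset.mem_map, addRightEmbedding_apply]
    constructor
    · intro hx
      rcases lt_or_ge x (m + 1) with h | h
      · exact Or.inl h
      · exact Or.inr ⟨x - (m + 1), by omega, by omega⟩
    · rintro (h | ⟨a, ha, rfl⟩) <;> omega
  have hdisj : Disjoint (Finset.range (m + 1))
      ((Finset.range (N - (m + 1))).map (addRightEmbedding (m + 1))) := by
    rw [Finset.disjoint_left]
    simp only [Finset.mem_range, Finset.mem_map, addRightEmbedding_apply]
    rintro x hx ⟨a, -, rfl⟩
    omega
  rw [hsplit, linExt_union hdisj, linExt_map, Finset.card_map, Finset.card_range,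
    Finset.card_range, Nat.add_sub_cancel' hm, linExt_eq_one, mul_one]
  · congr 1
    refine linExt_congr fun a _ b _ => ?_
    simp only [clusterRel, Finset.mem_map, addRightEmbedding_apply]
    constructor
    · rintro (h | ⟨_, ⟨s, hs, rfl⟩, h⟩)
      · omega
      · exact Or.inr ⟨s, hs, by omega⟩
    · rintro (h | ⟨s, hs, h⟩)
      · omega
      · exact Or.inr ⟨_, ⟨s, hs, rfl⟩, by omega⟩
  · intro a ha b hb
    rw [Finset.mem_range] at ha hb
    simp only [clusterRel, Finset.mem_map, addRightEmbedding_apply]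
    constructor
    · rintro (h | ⟨_, ⟨s, hs, rfl⟩, h⟩) <;> omega
    · intro h
      exact Or.inl ⟨h, by omega⟩
  · intro p hp q hq
    simp only [Finset.mem_range, Finset.mem_map, addRightEmbedding_apply] at hp hq
    obtain ⟨c, -, rfl⟩ := hq
    simp only [clusterRel, Finset.mem_map, addRightEmbedding_apply]
    constructor <;> rintro (h | ⟨_, ⟨s, hs, rfl⟩, h⟩) <;> omega

theorem lastBlockSum_zero {t : R} {m N : ℕ} (hm : m < N) :
    lastBlockSum t m N 0 = N.choose (m + 1) * markedSum t 0 (N - (m + 1)) := by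
  have hset : (Finset.Ico (m + 2 * 0 + 1) (N - 3)).powerset =
      (Finset.Ico 0 (N - (m + 1) - 3)).powerset.image
        (Finset.map (addRightEmbedding (m + 1))) := by
    ext S
    simp only [Finset.mem_powerset, Finset.mem_image]
    constructor
    · intro hS
      have h1 : S ⊆ (Finset.Ico 0 (N - (m + 1) - 3)).map (addRightEmbedding (m + 1)) := by
        intro s hs
        have := Finset.mem_Ico.1 (hS hs)
        exact Finset.mem_map.2 ⟨s - (m + 1), Finset.mem_Ico.2 (by omega),
          by simp only [addRightEmbedding_apply]; omega⟩
      obtain ⟨T, hT, rfl⟩ := Finset.subset_map_iff.1 h1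
      exact ⟨T, hT, rfl⟩
    · rintro ⟨T, hT, rfl⟩ s hs
      obtain ⟨a, ha, rfl⟩ := Finset.mem_map.1 hs
      have := Finset.mem_Ico.1 (hT ha)
      simp only [addRightEmbedding_apply, Finset.mem_Ico]
      omega
  rw [lastBlockSum, hset, Finset.sum_image (Finset.map_injective _).injOn, markedSum,
    Finset.mul_sum]
  refine Finset.sum_congr rfl fun S _ => ?_
  have h0 : blockSet m 0 ∪ S.map (addRightEmbedding (m + 1)) =
      S.map (addRightEmbedding (m + 1)) := by simp [blockSet]
  rw [h0, linExt_of_isolated hm, Finset.card_map, zero_add]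
  push_cast
  ring

/-! ### The cluster generating function -/

open PowerSeries

/-- `∑_{j ≥ 0} C_{k + j} t ^ {k + j} x ^ {2 j}`, where `C` are the Catalan numbers. -/
noncomputable def catalanTail (t : R) (k : ℕ) : R⟦X⟧ :=
  PowerSeries.mk fun n => if 2 ∣ n then (catalan (k + n / 2) : R) * t ^ (k + n / 2) else 0

theorem catalanTail_eq (t : R) (k : ℕ) :
    catalanTail t k = C (catalan k * t ^ k) + X ^ 2 * catalanTail t (k + 1) := by
  ext n
  rw [map_add, coeff_C, PowerSeries.coeff_X_pow_mul', catalanTail, coeff_mk, catalanTail, coeff_mk]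
  rcases n with _ | _ | n
  · simp
  · simp
  · have h : 2 ∣ n + 2 ↔ 2 ∣ n := by omega
    simp [h, add_assoc, add_comm 1]

theorem catalanTail_zero (t : R) :
    catalanTail t 0 = 1 + C t * X ^ 2 * catalanTail t 0 ^ 2 := by
  -- The series is `c(t x²)`, so it inherits the quadratic equation of the Catalan series by
  -- substitution.
  have h : catalanTail t 0 =
      expand 2 two_ne_zero (rescale t (PowerSeries.map (Nat.castRingHom R) catalanSeries)) := by
    ext n
    rw [catalanTail, coeff_mk]
    split_ifs with hn
    · obtain ⟨m, rfl⟩ := hn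
      rw [coeff_expand_mul]
      simp [mul_comm]
    · rw [coeff_expand_of_not_dvd _ _ _ hn]
  have h1 := congrArg (fun f => expand 2 two_ne_zero
    (rescale t (PowerSeries.map (Nat.castRingHom R) f))) catalanSeries_sq_mul_X_add_one
  simp only [map_add, map_mul, map_pow, map_one, ← h, map_X, rescale_X, expand_X, expand_C] at h1
  linear_combination -h1

/-- The power series `x / (1 - x (c(t x²) - 1))`, where `c` is the Catalan generating function. -/
noncomputable def clusterSeries (t : R) : R⟦X⟧ :=
  X * Ring.inverse (1 - X ^ 3 * catalanTail t 1)

theorem inverse_mul_clusterDenominator (t : R) :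
    Ring.inverse (1 - X ^ 3 * catalanTail t 1) * (1 - X ^ 3 * catalanTail t 1) = 1 := by
  apply Ring.inverse_mul_cancel
  rw [PowerSeries.isUnit_iff_constantCoeff]
  simp

theorem clusterSeries_eq (t : R) :
    clusterSeries t = X + X ^ 3 * (catalanTail t 1 * clusterSeries t) := by
  have h := inverse_mul_clusterDenominator t
  rw [clusterSeries]
  linear_combination X * h

theorem coeff_zero_clusterSeries (t : R) : coeff 0 (clusterSeries t) = 0 := by
  simp [clusterSeries]

/-- Pairing of a power series, shifted by `m`, with the binomial transform of `markedSum`. -/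
noncomputable def pairing (t : R) (N m : ℕ) (F : R⟦X⟧) : R :=
  ∑ i ∈ Finset.Ico m (N + 1), coeff (i - m) F * (N.choose i * markedSum t 0 (N - i))

theorem pairing_add (t : R) (N m : ℕ) (F G : R⟦X⟧) :
    pairing t N m (F + G) = pairing t N m F + pairing t N m G := by
  simp only [pairing, map_add, add_mul, Finset.sum_add_distrib]

theorem pairing_C_mul (t : R) (N m : ℕ) (a : R) (F : R⟦X⟧) :
    pairing t N m (C a * F) = a * pairing t N m F := by
  simp only [pairing, coeff_C_mul, Finset.mul_sum, mul_assoc]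

theorem pairing_X_pow_mul (t : R) (N m k : ℕ) (F : R⟦X⟧) :
    pairing t N m (X ^ k * F) = pairing t N (m + k) F := by
  rw [pairing, pairing]
  symm
  apply Finset.sum_subset_zero_on_sdiff
  · intro i hi
    rw [Finset.mem_Ico] at hi ⊢
    omega
  · intro i hi
    rw [Finset.mem_sdiff, Finset.mem_Ico, Finset.mem_Ico] at hi
    rw [coeff_X_pow_mul', if_neg (by omega), zero_mul]
  · intro i hi
    rw [Finset.mem_Ico] at hi
    rw [coeff_X_pow_mul', if_pos (by omega), Nat.sub_sub]

theorem pairing_X {t : R} {N m : ℕ} (hm : m < N) :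
    pairing t N m X = N.choose (m + 1) * markedSum t 0 (N - (m + 1)) := by
  rw [pairing, Finset.sum_eq_single (m + 1)]
  · simp
  · intro i hi hne
    rw [Finset.mem_Ico] at hi
    rw [coeff_X, if_neg (by omega), zero_mul]
  · intro h
    exact absurd (Finset.mem_Ico.2 (by omega)) h

theorem pairing_eq_zero {t : R} {N m : ℕ} {F : R⟦X⟧} (hm : N ≤ m) (hF : coeff 0 F = 0) :
    pairing t N m F = 0 := by
  refine Finset.sum_eq_zero fun i hi => ?_
  rw [Finset.mem_Ico] at hi
  rw [show i - m = 0 by omega, hF, zero_mul]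

/-- The index `i` of the pairing is the size of the first cluster, and `m` counts the positions
before the last one of the run already built. The recursion on the first block mirrors
`clusterSeries_eq`, and lengthening a block by one mark mirrors `catalanTail_eq`. -/
theorem markedSum_eq_pairing (t : R) {m N : ℕ} (hm : m < N) :
    markedSum t m N = pairing t N m (clusterSeries t) := by
  induction hd : N - m using Nat.strong_induction_on generalizing m with
  | _ d ih =>
    have hzero : ∀ k, coeff 0 (catalanTail t k * clusterSeries t) = 0 := fun k => by
      rw [coeff_zero_eq_constantCoeff_apply, map_mul, ← coeff_zero_eq_constantCoeff_apply,
        ← coeff_zero_eq_constantCoeff_apply, coeff_zero_clusterSeries, mul_zero]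
    have hblock : ∀ e k, N - (m + 2 * k + 1) = e → 0 < k → m + 2 * k + 1 < N →
        blockSum t m N k = pairing t N (m + 2 * k + 1) (catalanTail t k * clusterSeries t) := by
      intro e
      induction e using Nat.strong_induction_on with
      | _ e ihe =>
        intro k he hk hN
        have hlast : lastBlockSum t m N k = pairing t N (m + 2 * k + 1)
            (C (catalan k * t ^ k) * clusterSeries t) := by
          rw [lastBlockSum_of_pos hk hN, pairing_C_mul, ih _ (by omega) hN rfl]
        rw [catalanTail_eq, add_mul, pairing_add, ← hlast, mul_assoc, pairing_X_pow_mul]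
        rcases lt_or_ge (m + 2 * k + 3) N with h | h
        · rw [blockSum_eq_add h, ihe _ (by omega) (k + 1) rfl (by omega) (by omega)]
          rfl
        · rw [blockSum_eq_last h, pairing_eq_zero (by omega) (hzero _), add_zero]
    rw [clusterSeries_eq, pairing_add, pairing_X hm, pairing_X_pow_mul, ← lastBlockSum_zero hm,
      ← blockSum_zero]
    rcases lt_or_ge (m + 3) N with h | h
    · rw [blockSum_eq_add (by omega), hblock _ 1 rfl (by omega) (by omega)]
    · rw [blockSum_eq_last (by omega), pairing_eq_zero h (hzero _), add_zero]

end

/-! ### Algebraic and differential equations of the cluster series -/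

section

open PowerSeries
variable {R : Type*} [CommRing R]

theorem catalanTail_one (t : R) : catalanTail t 1 = C t * (1 + X ^ 2 * catalanTail t 1) ^ 2 := by
  have h0 := catalanTail_zero t
  have h1 : catalanTail t 0 = 1 + X ^ 2 * catalanTail t 1 := by
    rw [catalanTail_eq]; simp
  rw [h1] at h0
  have h2 : X ^ 2 * catalanTail t 1 = X ^ 2 * (C t * (1 + X ^ 2 * catalanTail t 1) ^ 2) := by
    linear_combination h0
  -- The factor `X ^ 2` is cancelled by comparing coefficients of index `n + 2`.
  ext n
  simpa only [coeff_X_pow_mul] using congrArg (coeff (n + 2)) h2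

theorem exists_clusterSeries_eq (t : R) : ∃ M : R⟦X⟧, clusterSeries t = X * M ∧
    constantCoeff M = 1 ∧ M ^ 2 - M = C t * X * ((1 + X) * M - 1) ^ 2 := by
  refine ⟨_, rfl, ?_, ?_⟩
  · have h := congrArg constantCoeff (inverse_mul_clusterDenominator t)
    simpa using h
  · have h := inverse_mul_clusterDenominator t
    set M := Ring.inverse (1 - X ^ 3 * catalanTail t 1)
    have hT := catalanTail_one t
    have h1 : (1 + X) * M - 1 = X * M * (1 + X ^ 2 * catalanTail t 1) := by
      linear_combination h
    rw [h1]
    linear_combination M * h + X ^ 3 * M ^ 2 * hT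

/-- The first-order differential equation for `W = 1 - clusterSeries t`, which encodes the
recurrence for its coefficients. -/
theorem differential_eq_clusterSeries (t : R) (W : R⟦X⟧) (hW : W = 1 - clusterSeries t) :
    X * d⁄dX R W - W - C t * X * (X * d⁄dX R W) - 6 * C t * X ^ 2 * (X * d⁄dX R W - W)
      + X ^ 3 * ((4 * C t ^ 2 - C t) * (X * d⁄dX R W) - (4 * C t ^ 2 + 2 * C t) * W)
      + 8 * C t ^ 2 * X ^ 4 * (X * d⁄dX R W) + 4 * C t ^ 2 * X ^ 5 * (X * d⁄dX R W + W)
      = -1 + 7 * C t * X ^ 2 - (4 * C t ^ 2 + 2 * C t) * X ^ 3 := by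
  obtain ⟨M, hM, hM0, hF⟩ := exists_clusterSeries_eq t
  have hD := congrArg (d⁄dX R) hF
  have hDW : d⁄dX R W = -(M + X * d⁄dX R M) := by
    rw [hW, hM]
    simp only [map_sub, Derivation.map_one_eq_zero, Derivation.leibniz, derivative_X, smul_eq_mul]
    ring
  simp only [map_sub, map_add, Derivation.leibniz, Derivation.leibniz_pow, smul_eq_mul,
    derivative_X, derivative_C, Derivation.map_one_eq_zero, nsmul_eq_mul] at hD
  norm_num at hD
  rw [hDW, hW, hM]
  set D := d⁄dX R M
  -- This is the derivative in `M` of the quadratic relation `hF`, with constant term 1. After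
  -- multiplication by it the claim is a combination of `hF` and its derivative `hD`, which
  -- eliminates `D`.
  have hunit : IsUnit (2 * M - 1 - 2 * C t * X * (1 + X) * ((1 + X) * M - 1)) := by
    rw [PowerSeries.isUnit_iff_constantCoeff]
    have h2 : constantCoeff (2 : R⟦X⟧) = 2 := map_ofNat _ 2
    simp [hM0, h2]
    norm_num
  rw [← sub_eq_zero, ← hunit.mul_right_eq_zero]
  linear_combination (-X ^ 2 + C t * X ^ 3 + 6 * C t * X ^ 4 - (4 * C t ^ 2 - C t) * X ^ 5
    - 8 * C t ^ 2 * X ^ 6 - 4 * C t ^ 2 * X ^ 7) * hD + (C t * X ^ 2 - 4 * C t * X ^ 3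
    + 3 * C t * X ^ 4 + 4 * C t ^ 2 * X ^ 4 - 4 * C t ^ 2 * X ^ 6) * hF

/-- The recurrence satisfied by the coefficients of `1 - clusterSeries (u - 1)`, which is the
differential equation of `ω` on the level of exponential coefficients. -/
def OmegaRecurrence (u : R) (w : ℕ → R) : Prop :=
  ∀ n : ℕ, (n + 3) * w (n + 4) - (u - 1) * (n + 3) * w (n + 3)
    - (u - 1) * (6 * n + 6) * w (n + 2) + (u - 1) * ((4 * u - 5) * n - 3) * w (n + 1)
    + 8 * (u - 1) ^ 2 * n * w n + 4 * (u - 1) ^ 2 * n * w (n - 1) = 0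

theorem coeff_X_mul_derivative (n : ℕ) (W : R⟦X⟧) :
    coeff n (X * d⁄dX R W) = n * coeff n W := by
  rcases n with _ | n
  · simp
  · rw [coeff_succ_X_mul, coeff_derivative]
    push_cast
    ring

theorem coeff_one_sub_clusterSeries (t : R) : coeff 0 (1 - clusterSeries t) = 1 ∧
    coeff 1 (1 - clusterSeries t) = -1 ∧ coeff 2 (1 - clusterSeries t) = 0 ∧
    coeff 3 (1 - clusterSeries t) = 0 := by
  have h0 := coeff_zero_clusterSeries t
  have h (n : ℕ) : coeff n (clusterSeries t) = coeff n (X + X ^ 3 * (catalanTail t 1 *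
    clusterSeries t)) := by rw [← clusterSeries_eq]
  have h1 := h 1
  have h2 := h 2
  have h3 := h 3
  have hz : constantCoeff (clusterSeries t) = 0 := by simpa using h0
  simp [coeff_X_pow_mul', coeff_X] at h1 h2 h3
  simp [h1, h2, h3, hz, coeff_one]

theorem omegaRecurrence_clusterSeries (u : R) :
    OmegaRecurrence u fun n => coeff n (1 - clusterSeries (u - 1)) := by
  intro n
  have h := differential_eq_clusterSeries (u - 1) _ rfl
  obtain ⟨h0, -⟩ := coeff_one_sub_clusterSeries (u - 1)
  set W := 1 - clusterSeries (u - 1)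
  set T := X * d⁄dX R W with hT
  have hc (k : ℕ) : coeff k T = k * coeff k W := coeff_X_mul_derivative k W
  have h' : T - W - X ^ 1 * (C (u - 1) * T) - X ^ 2 * (C (6 * (u - 1)) * (T - W))
      + X ^ 3 * (C (4 * (u - 1) ^ 2 - (u - 1)) * T)
      - X ^ 3 * (C (4 * (u - 1) ^ 2 + 2 * (u - 1)) * W)
      + X ^ 4 * (C (8 * (u - 1) ^ 2) * T) + X ^ 5 * (C (4 * (u - 1) ^ 2) * (T + W))
      = -C 1 + X ^ 2 * C (7 * (u - 1)) - X ^ 3 * C (4 * (u - 1) ^ 2 + 2 * (u - 1)) := by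
    have e (k : ℕ) [k.AtLeastTwo] : C (OfNat.ofNat k : R) = OfNat.ofNat k := map_ofNat C k
    simp only [map_sub, map_add, map_mul, map_pow, map_one, e] at h ⊢
    linear_combination h
  -- The right-hand side has degree at most 3, so it disappears from index 4 on.
  have h4 := congrArg (coeff (n + 4)) h'
  simp only [LinearMap.map_add, LinearMap.map_sub, LinearMap.map_neg, coeff_X_pow_mul',
    coeff_C_mul, coeff_C, hc] at h4
  -- For `n = 0` the `X ^ 5` term does not contribute; in the recurrence the truncated `w (n - 1)`
  -- is then multiplied by 0.
  rcases n with _ | n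
  · simp at h4 ⊢
    linear_combination h4
  · simp [show n + 1 + 4 - 2 = n + 3 by omega, show n + 1 + 4 - 3 = n + 2 by omega] at h4 ⊢
    ring_nf at h4 ⊢
    linear_combination h4

end

/-! ### From ordinary coefficients to the equation for ω -/

section

open PowerSeries

variable {R : Type*} [CommRing R]

theorem factorial_mul_coeff_iterate_derivative (f : R⟦X⟧) (k n : ℕ) :
    (n ! : R) * coeff n ((fun g => d⁄dX R g)^[k] f) = ((n + k)! : R) * coeff (n + k) f := by
  induction k generalizing n with
  | zero => rfl
  | succ k ih =>
    rw [Function.iterate_succ_apply', coeff_derivative, show n + (k + 1) = n + 1 + k by ring, ← ih,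
      Nat.factorial_succ]
    push_cast
    ring

theorem factorial_mul_coeff_X_mul_iterate_derivative (f : R⟦X⟧) (k n : ℕ) :
    (n ! : R) * coeff n (X * (fun g => d⁄dX R g)^[k] f) =
      n * (((n - 1 + k)! : R) * coeff (n - 1 + k) f) := by
  rcases n with _ | n
  · simp
  · rw [coeff_succ_X_mul, Nat.add_sub_cancel, ← factorial_mul_coeff_iterate_derivative,
      Nat.factorial_succ]
    push_cast
    ring

/-- This is the case `m = 0` of `markedSum_eq_pairing`, where the initial run is a single position
and imposes no condition. -/
theorem sum_choose_mul_markedSum (t : R) {n : ℕ} (hn : 0 < n) :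
    ∑ k ∈ Finset.range (n + 1),
      coeff k (1 - clusterSeries t) * (n.choose k * markedSum t 0 (n - k)) = 0 := by
  have h := markedSum_eq_pairing t hn
  simp only [pairing, Nat.sub_zero, ← Finset.range_eq_Ico] at h
  simp only [map_sub, sub_mul, Finset.sum_sub_distrib, ← h]
  rw [Finset.sum_eq_single 0]
  · simp
  · intro k _ hk
    rw [coeff_one, if_neg hk, zero_mul]
  · simp

variable [Algebra ℚ R]

theorem isUnit_natCast {n : ℕ} (hn : n ≠ 0) : IsUnit (n : R) := by
  simpa using (IsUnit.mk0 (n : ℚ) (Nat.cast_ne_zero.2 hn)).map (algebraMap ℚ R)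

theorem OmegaRecurrence.ext {u : R} {w w' : ℕ → R} (h : OmegaRecurrence u w)
    (h' : OmegaRecurrence u w') (h0 : ∀ n < 4, w n = w' n) : w = w' := by
  funext n
  induction n using Nat.strong_induction_on with
  | _ n ih =>
    rcases lt_or_ge n 4 with hn | hn
    · exact h0 n hn
    · obtain ⟨n, rfl⟩ : ∃ m, n = m + 4 := ⟨n - 4, by omega⟩
      have hu : IsUnit ((n : R) + 3) := by
        exact_mod_cast isUnit_natCast (R := R) (n := n + 3) (by omega)
      have e := h n
      have e' := h' n
      rw [ih (n + 3) (by omega), ih (n + 2) (by omega), ih (n + 1) (by omega), ih n (by omega),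
        ih (n - 1) (by omega)] at e
      refine hu.mul_left_cancel ?_
      linear_combination e - e'

/-- With `w n = n! [zⁿ] f`, the operator `D ^ k` becomes the shift `w (n + k)` and `z D ^ k` becomes
`n * w (n - 1 + k)`. Multiplying the `n`-th coefficient by the unit `n!` loses nothing. -/
theorem differential_eq_iff_omegaRecurrence (u : R) (f : R⟦X⟧) {D : R⟦X⟧ → R⟦X⟧}
    (hD : D = fun g => d⁄dX R g) :
    (X * D^[5] f - ((C u - 1) * X - 3) * D^[4] f - 3 * (C u - 1) * (2 * X + 1) * D^[3] f
        + (C u - 1) * ((4 * C u - 5) * X - 6) * D^[2] f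
        + (C u - 1) * (8 * (C u - 1) * X - 3) * D f
        + 4 * (C u - 1) ^ 2 * X * f = 0) ↔
      OmegaRecurrence u fun n => (n ! : R) * coeff n f := by
  have hE : X * D^[5] f - ((C u - 1) * X - 3) * D^[4] f - 3 * (C u - 1) * (2 * X + 1) * D^[3] f
        + (C u - 1) * ((4 * C u - 5) * X - 6) * D^[2] f
        + (C u - 1) * (8 * (C u - 1) * X - 3) * D f
        + 4 * (C u - 1) ^ 2 * X * f =
      X * D^[5] f - C (u - 1) * (X * D^[4] f) + C 3 * D^[4] f - C (6 * (u - 1)) * (X * D^[3] f)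
        - C (3 * (u - 1)) * D^[3] f + C ((u - 1) * (4 * u - 5)) * (X * D^[2] f)
        - C (6 * (u - 1)) * D^[2] f + C (8 * (u - 1) ^ 2) * (X * D^[1] f)
        - C (3 * (u - 1)) * D^[1] f + C (4 * (u - 1) ^ 2) * (X * D^[0] f) := by
    have e (k : ℕ) [k.AtLeastTwo] : C (OfNat.ofNat k : R) = OfNat.ofNat k := map_ofNat C k
    simp only [map_sub, map_mul, map_pow, map_one, e, Function.iterate_one, Function.iterate_zero,
      id]
    ring
  rw [hE, PowerSeries.ext_iff]
  refine forall_congr' fun n => ?_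
  rw [map_zero]
  refine (isUnit_natCast (R := R) n.factorial_ne_zero).mul_right_eq_zero.symm.trans ?_
  have h1 (k : ℕ) := factorial_mul_coeff_iterate_derivative f k n
  have h2 (k : ℕ) := factorial_mul_coeff_X_mul_iterate_derivative f k n
  have h3 (k : ℕ) : (n ! : R) * coeff n (X * D^[k + 1] f) =
      n * (((n + k)! : R) * coeff (n + k) f) := by
    rw [hD, h2]
    rcases n with _ | n
    · simp
    · rw [Nat.add_sub_cancel, show n + (k + 1) = n + 1 + k by ring]
  rw [← hD] at h1 h2
  simp only [LinearMap.map_add, LinearMap.map_sub, coeff_C_mul]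
  refine Eq.congr_left ?_
  linear_combination h3 4 - (u - 1) * h3 3 + 3 * h1 4 - 6 * (u - 1) * h3 2 - 3 * (u - 1) * h1 3
    + (u - 1) * (4 * u - 5) * h3 1 - 6 * (u - 1) * h1 2 + 8 * (u - 1) ^ 2 * h3 0
    - 3 * (u - 1) * h1 1 + 4 * (u - 1) ^ 2 * h2 0

theorem algebraMap_factorial_inv_mul (n k : ℕ) (hk : k ≤ n) :
    algebraMap ℚ R (1 / (k ! : ℚ)) * algebraMap ℚ R (1 / ((n - k)! : ℚ)) =
      algebraMap ℚ R (1 / (n ! : ℚ)) * (n.choose k : R) := by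
  rw [← map_natCast (algebraMap ℚ R), ← map_mul, ← map_mul, Nat.cast_choose ℚ hk]
  congr 1
  have := n.factorial_ne_zero
  field_simp

/-- The binomial convolution in `sum_choose_mul_markedSum` says that the exponential series of `1 -
clusterSeries (u - 1)` times `genFun` is 1, and inverses are unique. -/
theorem omega_pattern1324_eq (u : R) : omega pattern1324 u =
    PowerSeries.mk fun n => algebraMap ℚ R (1 / (n ! : ℚ)) *
      coeff n (1 - clusterSeries (u - 1)) := by
  set W : R⟦X⟧ := PowerSeries.mk fun n => algebraMap ℚ R (1 / (n ! : ℚ)) *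
    coeff n (1 - clusterSeries (u - 1)) with hW
  have hA (n : ℕ) : ∑ π : Equiv.Perm (Fin n), u ^ occurrences pattern1324 π =
      markedSum (u - 1) 0 n := by
    rw [← sum_pow_occurrences, sub_add_cancel]
  have h1 : W * genFun pattern1324 u = 1 := by
    ext n
    rw [coeff_mul, Finset.Nat.sum_antidiagonal_eq_sum_range_succ
      fun i j => coeff i W * coeff j (genFun pattern1324 u)]
    have h2 : ∀ k ∈ Finset.range n.succ, coeff k W * coeff (n - k) (genFun pattern1324 u) =
        algebraMap ℚ R (1 / (n ! : ℚ)) * (coeff k (1 - clusterSeries (u - 1)) *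
          (n.choose k * markedSum (u - 1) 0 (n - k))) := by
      intro k hk
      have h3 := algebraMap_factorial_inv_mul (R := R) n k (by simpa [Nat.lt_succ_iff] using hk)
      rw [hW, genFun, coeff_mk, coeff_mk, hA]
      linear_combination coeff k (1 - clusterSeries (u - 1)) * markedSum (u - 1) 0 (n - k) * h3
    rw [Finset.sum_congr rfl h2, ← Finset.mul_sum]
    rcases n.eq_zero_or_pos with rfl | hn
    · simp [markedSum, coeff_zero_clusterSeries]
    · rw [sum_choose_mul_markedSum _ hn, mul_zero, coeff_one, if_neg hn.ne']
  calc omega pattern1324 u = W * genFun pattern1324 u * omega pattern1324 u := by rw [h1, one_mul]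
    _ = W := by rw [mul_assoc, genFun_mul_omega (by norm_num), mul_one]

theorem factorial_mul_coeff_omega (u : R) :
    (fun n : ℕ => (n ! : R) * coeff n (omega pattern1324 u)) =
      fun n => coeff n (1 - clusterSeries (u - 1)) := by
  funext n
  rw [omega_pattern1324_eq, coeff_mk, ← mul_assoc, ← map_natCast (algebraMap ℚ R), ← map_mul,
    mul_one_div_cancel (Nat.cast_ne_zero.2 n.factorial_ne_zero), map_one, one_mul]

end

end ConsecutivePattern

/-- `ω_{1324}(u, z)` is the solution of the stated fifth-order linear differential equation in `z`
with the stated initial values: a formal power series `f` in `z` satisfies the equation and the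
initial conditions if and only if `f = ω_{1324}(u, z)`. Here `X` is the variable `z`, `D` is the
derivative with respect to `z`, and `u` is an arbitrary element of a commutative `ℚ`-algebra
(for instance the indeterminate of `ℚ[u]`). -/
theorem mainTheorem2 {R : Type*} [CommRing R] [Algebra ℚ R] (u : R) (f : R⟦X⟧) :
    let D : R⟦X⟧ → R⟦X⟧ := fun g => PowerSeries.derivative R g
    let z : R⟦X⟧ := PowerSeries.X
    let v : R⟦X⟧ := PowerSeries.C u
    (z * D^[5] f - ((v - 1) * z - 3) * D^[4] f - 3 * (v - 1) * (2 * z + 1) * D^[3] f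
        + (v - 1) * ((4 * v - 5) * z - 6) * D^[2] f
        + (v - 1) * (8 * (v - 1) * z - 3) * D f
        + 4 * (v - 1) ^ 2 * z * f = 0
      ∧ PowerSeries.constantCoeff f = 1
      ∧ PowerSeries.constantCoeff (D f) = -1
      ∧ PowerSeries.constantCoeff (D^[2] f) = 0
      ∧ PowerSeries.constantCoeff (D^[3] f) = 0)
    ↔ f = ConsecutivePattern.omega ConsecutivePattern.pattern1324 u := by
  open ConsecutivePattern PowerSeries in
  intro D z v
  have hw := factorial_mul_coeff_omega u
  have hconst (g : R⟦X⟧) (k : ℕ) :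
      constantCoeff (D^[k] g) = (k ! : R) * coeff k g := by
    simpa using factorial_mul_coeff_iterate_derivative g k 0
  obtain ⟨c0, c1, c2, c3⟩ := coeff_one_sub_clusterSeries (u - 1)
  rw [show constantCoeff f = constantCoeff (D^[0] f) from rfl,
    show constantCoeff (D f) = constantCoeff (D^[1] f) from rfl, hconst, hconst, hconst, hconst]
  have hode := differential_eq_iff_omegaRecurrence u f (D := D) rfl
  refine (and_congr_left' hode).trans ⟨?_, ?_⟩
  · rintro ⟨h, h0, h1, h2, h3⟩
    have hrec : (fun n : ℕ => (n ! : R) * coeff n f) =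
        fun n => coeff n (1 - clusterSeries (u - 1)) := by
      refine h.ext (omegaRecurrence_clusterSeries u) fun n hn => ?_
      interval_cases n
      exacts [h0.trans c0.symm, h1.trans c1.symm, h2.trans c2.symm, h3.trans c3.symm]
    ext n
    exact (isUnit_natCast (R := R) n.factorial_ne_zero).mul_left_cancel
      (congrFun (hrec.trans hw.symm) n)
  · rintro rfl
    have hn (n : ℕ) := congrFun hw n
    rw [hw]
    exact ⟨omegaRecurrence_clusterSeries u, (hn 0).trans c0, (hn 1).trans c1, (hn 2).trans c2,
      (hn 3).trans c3⟩
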